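/- Let $n\ge 2$, let $T_n$ be the set of $n\times n$ permutation matrices $\pi$ with $\pi_{ij}=0$ whenever $j\ge i+2$, and let $P_n\subset\mathbb{R}^{n\times n}$ be the convex hull of $T_n$. Lattice points are matrices with integer entries, and the interior of a polytope means its relative interior (its interior within its affine hull). (i) If $t\ge 1$ is an integer and the interior of $t\cdot P_n$ contains a lattice point, then $t\ge \max_{0\le k\le n-1}(k+1)(n-k)$. (ii) There is a unique polynomial $e(P_n,\cdot)\in\mathbb{Q}[x]$, the Ehrhart polynomial of $P_n$, such that for every integer $t\ge 0$ the number of lattice points of $t\cdot P_n$ is $e(P_n,t)$. It satisfies: - if $n=2m+1$ is odd, then $e(P_n,-t)=0$ for $t=1,\dots,(m+1)^2-1$; - if $n=2m$ is even, then $e(P_n,-t)=0$ for $t=1,\dots,m(m+1)-1$. -/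

import Mathlib

open scoped Pointwise

/-- The set of `n × n` permutation matrices `π` with `π i j = 0` whenever `j ≥ i + 2`. -/
def permT (n : ℕ) : Set (Matrix (Fin n) (Fin n) ℝ) :=
  {A | (∃ σ : Equiv.Perm (Fin n), A = σ.permMatrix ℝ) ∧
    ∀ i j : Fin n, (i : ℕ) + 2 ≤ (j : ℕ) → A i j = 0}

/-- The polytope `P_n`, the convex hull of `permT n`. -/
def polyP (n : ℕ) : Set (Matrix (Fin n) (Fin n) ℝ) :=
  convexHull ℝ (permT n)

/-- The integer points of a set of real matrices, as integer matrices. -/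
def latticePoints {n : ℕ} (S : Set (Matrix (Fin n) (Fin n) ℝ)) :
    Set (Matrix (Fin n) (Fin n) ℤ) :=
  {A | A.map (fun z : ℤ => (z : ℝ)) ∈ S}

/-- `e` is the Ehrhart polynomial of the lattice polytope `P`: its value at every integer `t ≥ 0`
is the number of integer points of the dilate `t • P`. -/
def IsEhrhartPolynomial {n : ℕ} (P : Set (Matrix (Fin n) (Fin n) ℝ)) (e : Polynomial ℚ) : Prop :=
  ∀ t : ℕ, e.eval (t : ℚ) = ((latticePoints ((t : ℝ) • P)).ncard : ℚ)

/-!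
By Birkhoff's theorem on the face of the Birkhoff polytope where all entries above the superdiagonal
vanish, the lattice points of `t • P_n` are the nonnegative integer matrices with these zeros and
with all row and column sums `t` (`latticePoints_smul_polyP`).

*Positive matrices.* If such a matrix is positive on and below the diagonal, compare the columns
`≤ k`, of total sum `(k + 1) t`, with the rows `< k`, which are supported on these columns and have
total sum `k t`: the block of rows `≥ k` and columns `≤ k` has sum `t` and consists of
`(k + 1) (n - k)` positive entries, so `(k + 1) (n - k) ≤ t` (`mul_le_of_mem_bandedTransport`). An
interior point is positive there because it can be moved away from any vertex with a nonzero entry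
at the given position. This gives the lower bound on `t`.

*Counting.* The entries on and below the diagonal, read row by row, describe a process moving `t`
units, all at the vertex `0` initially: the entry `a` at `(i, j)` moves `a` units from vertex `j` to
vertex `i + 1`, subject only to `0 ≤ a ≤ y`, where `y` is the current content of `j`; the last row
is the final content, and the superdiagonal is determined by the row sums (`staircaseMatrix`). The
number of lattice points is therefore an iterated sum `∑_{a = 0}^{y}`. Continuing each such sum to
negative `y` as `-∑_{y < a < 0}` makes the iterated sum (`runCount`) a polynomial in the initial
contents on all of `ℤ`, by Faulhaber's formula (`exists_mvPolynomial_runCount`). This provides the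
Ehrhart polynomial, and it computes its values at negative integers as well, with no appeal to
Ehrhart–Macdonald reciprocity.

*Vanishing.* If the value at `-t` is nonzero, some term of the iterated sum occurs. All its amounts
and final contents are strictly negative (`IsRun.neg`), so its negative is a matrix with row and
column sums `t` that is positive on and below the diagonal, and `(k + 1) (n - k) ≤ t` for all `k`
(`le_of_staircaseCount_neg_ne_zero`).
-/

/-! ### Signed sums over integer intervals -/

/-- The sum `∑_{a = 0}^{y} f a`, continued to negative `y` so that its difference in `y` is always
`f y`: for `y < 0` it is `-∑_{y < a < 0} f a`. -/
noncomputable def signedSum (y : ℤ) (f : ℤ → ℚ) : ℚ :=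
  if 0 ≤ y then ∑ a ∈ Finset.Icc 0 y, f a else -∑ a ∈ Finset.Ioo y 0, f a

lemma signedSum_neg_one (f : ℤ → ℚ) : signedSum (-1) f = 0 := by
  have : Finset.Ioo (-1 : ℤ) 0 = ∅ := by decide
  simp [signedSum, this]

lemma signedSum_eq_add (y : ℤ) (f : ℤ → ℚ) :
    signedSum y f = signedSum (y - 1) f + f y := by
  unfold signedSum
  rcases lt_trichotomy y 0 with h | rfl | h
  · have hI : Finset.Ioo (y - 1) 0 = insert y (Finset.Ioo y 0) := by
      ext a; simp only [Finset.mem_Ioo, Finset.mem_insert]; omega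
    rw [if_neg (by omega), if_neg (by omega), hI, Finset.sum_insert (by simp)]
    ring
  · have : Finset.Ioo (-1 : ℤ) 0 = ∅ := by decide
    simp [this]
  · have hI : Finset.Icc 0 y = insert y (Finset.Icc 0 (y - 1)) := by
      ext a; simp only [Finset.mem_Icc, Finset.mem_insert]; omega
    rw [if_pos (by omega), if_pos (by omega), hI, Finset.sum_insert (by simp)]
    ring

lemma signedSum_finset_sum {ι : Type*} (s : Finset ι) (y : ℤ) (f : ι → ℤ → ℚ) :
    signedSum y (fun a => ∑ i ∈ s, f i a) = ∑ i ∈ s, signedSum y (f i) := by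
  unfold signedSum
  split_ifs
  · exact Finset.sum_comm
  · rw [Finset.sum_comm, Finset.sum_neg_distrib]

lemma signedSum_mul_left (y : ℤ) (c : ℚ) (f : ℤ → ℚ) :
    signedSum y (fun a => c * f a) = c * signedSum y f := by
  unfold signedSum
  split_ifs
  · rw [Finset.mul_sum]
  · rw [← Finset.mul_sum, mul_neg]

/-- Faulhaber's formula, valid at negative arguments too because `signedSum` satisfies its
difference equation on all of `ℤ`. -/
lemma exists_polynomial_signedSum_pow (k : ℕ) :
    ∃ S : Polynomial ℚ, ∀ y : ℤ, signedSum y (fun a => (a : ℚ) ^ k) = S.eval (y : ℚ) := by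
  let B := Polynomial.bernoulli (k + 1)
  have hk : (k + 1 : ℚ) ≠ 0 := by positivity
  refine ⟨Polynomial.C ((k + 1 : ℚ)⁻¹) *
    (B.comp (1 + Polynomial.X) - Polynomial.C (B.eval 0)), fun y => ?_⟩
  have hstep : ∀ z : ℚ, B.eval (1 + z) = B.eval z + (k + 1) * z ^ k := fun z => by
    simpa using Polynomial.bernoulli_eval_one_add (k + 1) z
  simp only [Polynomial.eval_mul, Polynomial.eval_C, Polynomial.eval_sub, Polynomial.eval_comp,
    Polynomial.eval_add, Polynomial.eval_one, Polynomial.eval_X]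
  induction y using Int.inductionOn' (b := -1) with
  | zero => simp [signedSum_neg_one]
  | succ j _ ih =>
    rw [signedSum_eq_add, add_sub_cancel_right, ih]
    have h := hstep (j + 1)
    push_cast
    rw [h, show (1 : ℚ) + j = j + 1 by ring]
    field_simp
    ring
  | pred j _ ih =>
    rw [signedSum_eq_add, hstep, ← eq_sub_iff_add_eq] at ih
    push_cast
    rw [show (1 : ℚ) + (j - 1) = j by ring, ih]
    field_simp
    ring

/-- The range of summation of `signedSum`. -/
noncomputable def signedRange (y : ℤ) : Finset ℤ :=
  if 0 ≤ y then Finset.Icc 0 y else Finset.Ioo y 0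

lemma signedRange_of_nonneg {y : ℤ} (h : 0 ≤ y) : signedRange y = Finset.Icc 0 y := if_pos h

lemma signedRange_of_neg {y : ℤ} (h : y < 0) : signedRange y = Finset.Ioo y 0 :=
  if_neg (not_le.2 h)

lemma exists_ne_zero_of_signedSum_ne_zero {y : ℤ} {f : ℤ → ℚ} (h : signedSum y f ≠ 0) :
    ∃ a ∈ signedRange y, f a ≠ 0 := by
  unfold signedSum at h
  unfold signedRange
  split_ifs at h ⊢
  · exact Finset.exists_ne_zero_of_sum_ne_zero h
  · exact Finset.exists_ne_zero_of_sum_ne_zero (neg_ne_zero.1 h)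

/-! ### Runs of transfers along a list of edges -/

section Runs

variable {V E : Type*} [DecidableEq V]

/-- Move `a` units from the vertex `u` to the vertex `v`. -/
def transfer (x : V → ℤ) (u v : V) (a : ℤ) : V → ℤ :=
  x + a • (Pi.single v 1 - Pi.single u 1)

lemma transfer_apply (x : V → ℤ) (u v : V) (a : ℤ) (w : V) :
    transfer x u v a w = x w + (if w = v then a else 0) - (if w = u then a else 0) := by
  simp only [transfer, Pi.add_apply, Pi.smul_apply, Pi.sub_apply, Pi.single_apply, smul_eq_mul]
  split_ifs <;> ring

variable (src tgt : E → V)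

/-- `a : E → ℤ` is a run of the list `L` of edges from the state `x` when, performing the
transfers of `a e` units along the edges `e` of `L` in order, each amount lies in the range
`[0, y]`, respectively `(y, 0)`, given by the current content `y` of the source of `e`. -/
def IsRun : List E → (V → ℤ) → (E → ℤ) → Prop
  | [], _, _ => True
  | e :: L, x, a => a e ∈ signedRange (x (src e)) ∧
      IsRun L (transfer x (src e) (tgt e) (a e)) a

/-- The number of runs of `L` from `x`, each summation being replaced by its signed continuation
where the current content of the source is negative. -/
noncomputable def runCount : List E → (V → ℤ) → ℚ
  | [], _ => 1
  | e :: L, x => signedSum (x (src e)) fun a => runCount L (transfer x (src e) (tgt e) a)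

/-- The state reached from `x` after the transfers `a` along the edges of `L`. -/
def finalState (L : List E) (x : V → ℤ) (a : E → ℤ) : V → ℤ :=
  x + (L.map fun e => a e • (Pi.single (tgt e) (1 : ℤ) - Pi.single (src e) 1 : V → ℤ)).sum

lemma finalState_nil (x : V → ℤ) (a : E → ℤ) : finalState src tgt [] x a = x := by
  simp [finalState]

lemma finalState_cons (e : E) (L : List E) (x : V → ℤ) (a : E → ℤ) :
    finalState src tgt (e :: L) x a =
      finalState src tgt L (transfer x (src e) (tgt e) (a e)) a := by
  simp [finalState, transfer, add_assoc]

lemma finalState_neg (L : List E) (x : V → ℤ) (a : E → ℤ) :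
    finalState src tgt L (-x) (-a) = -finalState src tgt L x a := by
  induction L generalizing x with
  | nil => simp [finalState_nil]
  | cons e L ih =>
    rw [finalState_cons, finalState_cons, ← ih]
    congr 1
    simp [transfer, add_comm]

lemma finalState_apply [DecidableEq E] {L : List E} (hL : L.Nodup) (x : V → ℤ) (a : E → ℤ) (v : V) :
    finalState src tgt L x a v = x v + ∑ e ∈ L.toFinset, (if v = tgt e then a e else 0) -
      ∑ e ∈ L.toFinset, (if v = src e then a e else 0) := by
  rw [finalState, ← List.sum_toFinset _ hL, add_sub_assoc, ← Finset.sum_sub_distrib]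
  simp only [Pi.add_apply, Finset.sum_apply, Pi.smul_apply, Pi.sub_apply, Pi.single_apply,
    smul_eq_mul]
  congr 1
  refine Finset.sum_congr rfl fun e _ => ?_
  split_ifs <;> ring

variable {src tgt}

lemma IsRun.congr {L : List E} {x : V → ℤ} {a b : E → ℤ} (h : ∀ e ∈ L, a e = b e)
    (ha : IsRun src tgt L x a) : IsRun src tgt L x b := by
  induction L generalizing x with
  | nil => trivial
  | cons e L ih =>
    have he := h e (by simp)
    refine ⟨he ▸ ha.1, ?_⟩
    rw [← he]
    exact ih (fun e' h' => h e' (by simp [h'])) ha.2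

lemma transfer_nonneg {x : V → ℤ} (hx : ∀ v, 0 ≤ x v) {u v : V} {a : ℤ} (h0 : 0 ≤ a)
    (h1 : a ≤ x u) (w : V) : 0 ≤ transfer x u v a w := by
  rw [transfer_apply]
  have := hx w
  split_ifs with h2 h3 h3 <;> subst_vars <;> omega

/-- From a nonnegative state, `runCount` is a genuine cardinality. -/
lemma exists_finset_card_eq_runCount [DecidableEq E] [Finite E] {L : List E} (hL : L.Nodup)
    {x : V → ℤ} (hx : ∀ v, 0 ≤ x v) :
    ∃ s : Finset (E → ℤ), (∀ a, a ∈ s ↔ IsRun src tgt L x a ∧ ∀ e ∉ L, a e = 0) ∧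
      runCount src tgt L x = s.card := by
  classical
  induction L generalizing x with
  | nil =>
    refine ⟨{0}, fun a => ?_, by simp [runCount]⟩
    simp [IsRun, funext_iff]
  | cons e L ih =>
    obtain ⟨heL, hL⟩ := List.nodup_cons.1 hL
    have hstep : ∀ v : Finset.Icc 0 (x (src e)), ∃ s : Finset (E → ℤ),
        (∀ a, a ∈ s ↔ IsRun src tgt L (transfer x (src e) (tgt e) v) a ∧ ∀ e ∉ L, a e = 0) ∧
        runCount src tgt L (transfer x (src e) (tgt e) v) = s.card := fun v =>
      ih hL (transfer_nonneg hx (Finset.mem_Icc.1 v.2).1 (Finset.mem_Icc.1 v.2).2)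
    choose s hs hcard using hstep
    have hupd : ∀ v, ∀ b ∈ s v, ∀ w, Function.update (Function.update b e w) e 0 = b := by
      intro v b hb w
      rw [Function.update_idem, Function.update_eq_self_iff]
      exact (((hs v b).1 hb).2 e heL).symm
    refine ⟨Finset.univ.biUnion fun v => (s v).image fun b => Function.update b e v,
      fun a => ?_, ?_⟩
    · simp only [Finset.mem_biUnion, Finset.mem_univ, true_and, Finset.mem_image]
      constructor
      · rintro ⟨v, b, hb, rfl⟩
        obtain ⟨hrun, hzero⟩ := (hs v b).1 hb
        refine ⟨⟨?_, ?_⟩, fun e' he' => ?_⟩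
        · rw [Function.update_self, signedRange_of_nonneg (hx _)]
          exact v.2
        · rw [Function.update_self]
          refine hrun.congr fun e' he' => ?_
          rw [Function.update_of_ne]
          rintro rfl
          exact heL he'
        · simp only [List.mem_cons, not_or] at he'
          rw [Function.update_of_ne he'.1]
          exact hzero e' he'.2
      · rintro ⟨⟨h1, h2⟩, h3⟩
        rw [signedRange_of_nonneg (hx _)] at h1
        refine ⟨⟨a e, h1⟩, Function.update a e 0, (hs _ _).2 ⟨?_, fun e' he' => ?_⟩, by simp⟩
        · refine h2.congr fun e' he' => ?_
          rw [Function.update_of_ne]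
          rintro rfl
          exact heL he'
        · by_cases h : e' = e
          · simp [h]
          · rw [Function.update_of_ne h]
            exact h3 e' (by simp [h, he'])
    · rw [Finset.card_biUnion]
      · have hinj : ∀ v, ((s v).image fun b => Function.update b e (v : ℤ)).card = (s v).card := by
          intro v
          refine Finset.card_image_of_injOn fun b hb c hc hbc => ?_
          rw [← hupd v b hb v, ← hupd v c hc v]
          exact congrArg (fun d => Function.update d e 0) hbc
        simp only [hinj]
        push_cast
        simp only [← hcard]
        rw [runCount, signedSum, if_pos (hx _)]
        exact (Finset.sum_coe_sort (Finset.Icc 0 (x (src e))) fun a =>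
          runCount src tgt L (transfer x (src e) (tgt e) a)).symm
      · intro v _ w _ hvw
        rw [Function.onFun, Finset.disjoint_left]
        simp only [Finset.mem_image, not_exists, not_and]
        rintro _ ⟨b, _, rfl⟩ c _ hbc
        exact hvw (Subtype.ext (by simpa using (congrFun hbc e).symm))

lemma exists_isRun_of_runCount_ne_zero [DecidableEq E] {L : List E} (hL : L.Nodup)
    {x : V → ℤ} (h : runCount src tgt L x ≠ 0) : ∃ a, IsRun src tgt L x a := by
  induction L generalizing x with
  | nil => exact ⟨0, trivial⟩
  | cons e L ih =>
    obtain ⟨heL, hL⟩ := List.nodup_cons.1 hL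
    obtain ⟨v, hv, hne⟩ := exists_ne_zero_of_signedSum_ne_zero h
    obtain ⟨a, ha⟩ := ih hL hne
    refine ⟨Function.update a e v, by simpa using hv, ?_⟩
    rw [Function.update_self]
    refine ha.congr fun e' he' => ?_
    rw [Function.update_of_ne]
    rintro rfl
    exact heL he'

lemma finalState_le {L : List E} {x : V → ℤ} {a : E → ℤ} (ha : ∀ e ∈ L, 0 ≤ a e) {v : V}
    (hv : ∀ e ∈ L, tgt e ≠ v) : finalState src tgt L x a v ≤ x v := by
  induction L generalizing x with
  | nil => rw [finalState_nil]
  | cons e L ih =>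
    rw [finalState_cons]
    refine (ih (fun e' h => ha e' (by simp [h])) fun e' h => hv e' (by simp [h])).trans ?_
    have h1 := ha e (by simp)
    rw [transfer_apply, if_neg (hv e (by simp)).symm]
    split_ifs <;> omega

/-- If no vertex receives after it has been a source, a run from a nonnegative state is just a
nonnegative assignment of amounts with nonnegative final state: the intermediate constraints
follow, as a vertex only loses content once it has been a source. -/
lemma isRun_iff_of_nonneg {L : List E} (hL : L.Pairwise fun e f => tgt f ≠ src e)
    (hloop : ∀ e ∈ L, tgt e ≠ src e) {x : V → ℤ} (hx : ∀ v, 0 ≤ x v) {a : E → ℤ} :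
    IsRun src tgt L x a ↔ (∀ e ∈ L, 0 ≤ a e) ∧ ∀ v, 0 ≤ finalState src tgt L x a v := by
  induction L generalizing x with
  | nil => simp [IsRun, finalState_nil, hx]
  | cons e L ih =>
    obtain ⟨he, hL⟩ := List.pairwise_cons.1 hL
    have hloop' : ∀ f ∈ L, tgt f ≠ src f := fun f hf => hloop f (by simp [hf])
    rw [finalState_cons, IsRun, signedRange_of_nonneg (hx _), Finset.mem_Icc]
    constructor
    · rintro ⟨⟨h0, h1⟩, h2⟩
      rw [ih hL hloop' (transfer_nonneg hx h0 h1)] at h2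
      exact ⟨List.forall_mem_cons.2 ⟨h0, h2.1⟩, h2.2⟩
    · rintro ⟨h0, h2⟩
      obtain ⟨h0, h0'⟩ := List.forall_mem_cons.1 h0
      have h1 := (h2 (src e)).trans (finalState_le h0' he)
      rw [transfer_apply, if_neg (hloop e (by simp)).symm, if_pos rfl] at h1
      have h1 : a e ≤ x (src e) := by omega
      exact ⟨⟨h0, h1⟩, (ih hL hloop' (transfer_nonneg hx h0 h1)).2 ⟨h0', h2⟩⟩

/-- If every source has negative content when its turn comes, initially (the set `S`) or because
it received before, then a run from a nonpositive state moves strictly negative amounts and leaves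
strictly negative contents. -/
lemma IsRun.neg {L : List E} {S : Set V} {x : V → ℤ} {a : E → ℤ} (hx : ∀ v, x v ≤ 0)
    (hS : ∀ v ∈ S, x v < 0)
    (hL : ∀ L₁ e L₂, L = L₁ ++ e :: L₂ → src e ∈ S ∨ ∃ f ∈ L₁, tgt f = src e)
    (ha : IsRun src tgt L x a) :
    (∀ e ∈ L, a e < 0) ∧ ∀ v, (v ∈ S ∨ ∃ e ∈ L, tgt e = v) → finalState src tgt L x a v < 0 := by
  induction L generalizing x S with
  | nil =>
    refine ⟨by simp, fun v hv => ?_⟩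
    rw [finalState_nil]
    exact hS v (by simpa using hv)
  | cons e L ih =>
    have hsrc : x (src e) < 0 := hS _ (by simpa using hL [] e L rfl)
    obtain ⟨h1, h2⟩ := ha
    rw [signedRange_of_neg hsrc, Finset.mem_Ioo] at h1
    have hmem : ∀ v ∈ insert (tgt e) S, transfer x (src e) (tgt e) (a e) v < 0 := by
      intro v hv
      rw [transfer_apply]
      have := hx v
      rcases hv with rfl | hv
      · rw [if_pos rfl]
        split_ifs with h3
        · rw [← h3] at hsrc h1
          omega
        · omega
      · have := hS v hv
        split_ifs with h3 h4 h4 <;> subst_vars <;> omega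
    have hle : ∀ v, transfer x (src e) (tgt e) (a e) v ≤ 0 := by
      intro v
      rw [transfer_apply]
      have := hx v
      split_ifs with h3 h4 h4 <;> subst_vars <;> omega
    obtain ⟨h3, h4⟩ := ih hle hmem (by
      rintro L₁ f L₂ rfl
      rcases hL (e :: L₁) f L₂ rfl with h | ⟨g, hg, hgf⟩
      · exact Or.inl (Or.inr h)
      · rcases List.mem_cons.1 hg with rfl | hg
        · exact Or.inl (Or.inl hgf.symm)
        · exact Or.inr ⟨g, hg, hgf⟩) h2
    refine ⟨List.forall_mem_cons.2 ⟨h1.2, h3⟩, fun v hv => ?_⟩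
    rw [finalState_cons]
    refine h4 v ?_
    rcases hv with hv | ⟨f, hf, rfl⟩
    · exact Or.inl (Or.inr hv)
    · rcases List.mem_cons.1 hf with rfl | hf
      · exact Or.inl (Or.inl rfl)
      · exact Or.inr ⟨f, hf, rfl⟩

/-! ### The signed number of runs is polynomial in the initial state -/

/-- A signed sum of a polynomial along a line is again polynomial: expand in powers of the
parameter of the line and sum these by Faulhaber's formula. -/
lemma exists_mvPolynomial_signedSum (P : MvPolynomial V ℚ) (u v : V) :
    ∃ Q : MvPolynomial V ℚ, ∀ x : V → ℤ,
      signedSum (x u) (fun a => MvPolynomial.eval (fun w => (transfer x u v a w : ℚ)) P) =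
        MvPolynomial.eval (fun w => (x w : ℚ)) Q := by
  choose S hS using exists_polynomial_signedSum_pow
  let d : V → ℚ := fun w => (if w = v then 1 else 0) - (if w = u then 1 else 0)
  let R : Polynomial (MvPolynomial V ℚ) := MvPolynomial.aeval
    (fun w => Polynomial.C (MvPolynomial.X w) +
      Polynomial.C (MvPolynomial.C (d w)) * Polynomial.X) P
  have hR : ∀ (x : V → ℤ) (a : ℤ),
      MvPolynomial.eval (fun w => (transfer x u v a w : ℚ)) P =
        ∑ k ∈ Finset.range (R.natDegree + 1),
          MvPolynomial.eval (fun w => (x w : ℚ)) (R.coeff k) * (a : ℚ) ^ k := by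
    intro x a
    rw [← Polynomial.eval₂_eq_sum_range]
    change _ = Polynomial.eval₂RingHom (MvPolynomial.eval fun w => (x w : ℚ)) (a : ℚ) R
    simp only [R, MvPolynomial.aeval_def, MvPolynomial.hom_eval₂]
    rw [MvPolynomial.eval, MvPolynomial.coe_eval₂Hom]
    congr 1
    · ext; simp
    · funext w
      simp only [transfer_apply, d]
      split_ifs <;> simp [sub_eq_add_neg]
  refine ⟨∑ k ∈ Finset.range (R.natDegree + 1),
    R.coeff k * Polynomial.aeval (MvPolynomial.X u) (S k), fun x => ?_⟩
  simp only [hR]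
  rw [signedSum_finset_sum, map_sum]
  refine Finset.sum_congr rfl fun k _ => ?_
  rw [signedSum_mul_left, hS, map_mul]
  congr 1
  rw [← MvPolynomial.coe_aeval_eq_eval]
  change _ = MvPolynomial.aeval (fun w => (x w : ℚ)) _
  rw [← Polynomial.aeval_algHom_apply]
  simp

lemma exists_mvPolynomial_runCount (L : List E) :
    ∃ P : MvPolynomial V ℚ, ∀ x : V → ℤ,
      runCount src tgt L x = MvPolynomial.eval (fun v => (x v : ℚ)) P := by
  induction L with
  | nil => exact ⟨1, fun x => by simp [runCount]⟩
  | cons e L ih =>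
    obtain ⟨P, hP⟩ := ih
    obtain ⟨Q, hQ⟩ := exists_mvPolynomial_signedSum P (src e) (tgt e)
    exact ⟨Q, fun x => by simp only [runCount, hP, hQ]⟩

lemma exists_polynomial_runCount_single (L : List E) (v : V) :
    ∃ P : Polynomial ℚ, ∀ t : ℤ, runCount src tgt L (Pi.single v t) = P.eval (t : ℚ) := by
  obtain ⟨P, hP⟩ := exists_mvPolynomial_runCount (src := src) (tgt := tgt) L
  refine ⟨MvPolynomial.aeval (fun w => if w = v then Polynomial.X else 0) P, fun t => ?_⟩
  rw [hP, ← Polynomial.coe_evalRingHom, MvPolynomial.aeval_def, MvPolynomial.hom_eval₂,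
    MvPolynomial.eval, MvPolynomial.coe_eval₂Hom]
  congr 1
  · ext; simp
  · funext w
    simp only [Pi.single_apply, Polynomial.coe_evalRingHom]
    split_ifs <;> simp

end Runs

/-! ### The dilated polytope as a transportation polytope -/

/-- Nonnegative `n × n` matrices over `R` that vanish above the superdiagonal and have all row and
column sums equal to `t`. -/
def bandedTransport (R : Type*) [CommRing R] [PartialOrder R] (n : ℕ) (t : R) :
    Set (Matrix (Fin n) (Fin n) R) :=
  {A | (∀ i j, 0 ≤ A i j) ∧ (∀ i j : Fin n, (i : ℕ) + 2 ≤ (j : ℕ) → A i j = 0) ∧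
    (∀ i, ∑ j, A i j = t) ∧ ∀ j, ∑ i, A i j = t}

lemma one_mem_permT (n : ℕ) : (1 : Matrix (Fin n) (Fin n) ℝ) ∈ permT n := by
  refine ⟨⟨1, by simp⟩, fun i j h => Matrix.one_apply_ne ?_⟩
  rintro rfl
  omega

lemma permT_subset_bandedTransport (n : ℕ) : permT n ⊆ bandedTransport ℝ n 1 := by
  rintro _ ⟨⟨σ, rfl⟩, h⟩
  have hσ := permMatrix_mem_doublyStochastic (R := ℝ) (σ := σ)
  exact ⟨fun i j => nonneg_of_mem_doublyStochastic hσ, h, sum_row_of_mem_doublyStochastic hσ,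
    sum_col_of_mem_doublyStochastic hσ⟩

lemma convex_bandedTransport (n : ℕ) (t : ℝ) : Convex ℝ (bandedTransport ℝ n t) := by
  rintro A ⟨hA0, hA1, hA2, hA3⟩ B ⟨hB0, hB1, hB2, hB3⟩ a b ha hb hab
  refine ⟨fun i j => ?_, fun i j h => ?_, fun i => ?_, fun j => ?_⟩
  · have := hA0 i j
    have := hB0 i j
    simp only [Matrix.add_apply, Matrix.smul_apply, smul_eq_mul]
    positivity
  · simp [hA1 i j h, hB1 i j h]
  · simp only [Matrix.add_apply, Matrix.smul_apply, smul_eq_mul, Finset.sum_add_distrib,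
      ← Finset.mul_sum, hA2, hB2, ← add_mul, hab, one_mul]
  · simp only [Matrix.add_apply, Matrix.smul_apply, smul_eq_mul, Finset.sum_add_distrib,
      ← Finset.mul_sum, hA3, hB3, ← add_mul, hab, one_mul]

/-- Birkhoff's theorem on the face of the Birkhoff polytope where the entries above the
superdiagonal vanish: permutation matrices of positive weight inherit these zeros. -/
lemma polyP_eq_bandedTransport (n : ℕ) : polyP n = bandedTransport ℝ n 1 := by
  refine (convexHull_min (permT_subset_bandedTransport n) (convex_bandedTransport n 1)).antisymm ?_
  rintro B ⟨hB0, hB1, hB2, hB3⟩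
  obtain ⟨w, hw0, hw1, hwB⟩ := exists_eq_sum_perm_of_mem_doublyStochastic
    (mem_doublyStochastic_iff_sum.2 ⟨hB0, hB2, hB3⟩)
  let z : Equiv.Perm (Fin n) → Matrix (Fin n) (Fin n) ℝ := fun σ =>
    if w σ = 0 then 1 else σ.permMatrix ℝ
  have hz : ∑ σ, w σ • z σ = B := by
    rw [← hwB]
    refine Finset.sum_congr rfl fun σ _ => ?_
    by_cases h : w σ = 0 <;> simp [z, h]
  rw [← hz]
  refine (convex_convexHull ℝ _).sum_mem (fun σ _ => hw0 σ) hw1 fun σ _ =>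
    subset_convexHull ℝ _ ?_
  by_cases h : w σ = 0
  · simpa [z, h] using one_mem_permT n
  · simp only [z, h, if_false]
    refine ⟨⟨σ, rfl⟩, fun i j hij => ?_⟩
    have hsum : ∑ τ, w τ * τ.permMatrix ℝ i j = 0 := by
      rw [← hB1 i j hij, ← hwB, Matrix.sum_apply]
      simp only [Matrix.smul_apply, smul_eq_mul]
    have := (Finset.sum_eq_zero_iff_of_nonneg fun τ _ => mul_nonneg (hw0 τ)
      (nonneg_of_mem_doublyStochastic permMatrix_mem_doublyStochastic)).1 hsum σ
      (Finset.mem_univ σ)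
    exact (mul_eq_zero.1 this).resolve_left h

lemma smul_polyP_eq_bandedTransport (n : ℕ) {t : ℝ} (ht : 0 ≤ t) :
    t • polyP n = bandedTransport ℝ n t := by
  rw [polyP_eq_bandedTransport]
  rcases ht.eq_or_lt with rfl | ht
  · have hne : (bandedTransport ℝ n 1).Nonempty :=
      ⟨1, permT_subset_bandedTransport n (one_mem_permT n)⟩
    rw [Set.zero_smul_set hne]
    ext A
    refine ⟨?_, fun h => ?_⟩
    · rintro rfl
      exact ⟨by simp, by simp, by simp, by simp⟩
    · ext i j
      exact (Finset.sum_eq_zero_iff_of_nonneg fun j _ => h.1 i j).1 (h.2.2.1 i) j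
        (Finset.mem_univ j)
  · ext A
    rw [Set.mem_smul_set_iff_inv_smul_mem₀ ht.ne']
    simp only [bandedTransport, Set.mem_ofPred_eq, Matrix.smul_apply, smul_eq_mul,
      ← Finset.mul_sum, inv_mul_eq_one₀ ht.ne', mul_eq_zero, inv_eq_zero, ht.ne', false_or,
      mul_nonneg_iff_of_pos_left (inv_pos.2 ht), eq_comm (a := t)]

lemma latticePoints_smul_polyP (n t : ℕ) :
    latticePoints ((t : ℝ) • polyP n) = bandedTransport ℤ n (t : ℤ) := by
  rw [smul_polyP_eq_bandedTransport n t.cast_nonneg]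
  ext A
  simp only [latticePoints, bandedTransport, Set.mem_ofPred_eq, Matrix.map_apply]
  norm_cast

/-! ### Positive lattice points -/

/-- The block with rows `≥ k` and columns `≤ k` has entry sum `t`: the columns `≤ k` have total
sum `(k + 1) t`, of which the rows `< k`, supported on these columns, take `k t`. -/
lemma mul_le_of_mem_bandedTransport {n : ℕ} {t : ℤ} {A : Matrix (Fin n) (Fin n) ℤ}
    (hA : A ∈ bandedTransport ℤ n t) (hpos : ∀ i j, j ≤ i → 0 < A i j) (k : Fin n) :
    ((k : ℤ) + 1) * (n - k) ≤ t := by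
  obtain ⟨-, hzero, hrow, hcol⟩ := hA
  have hcols : ∑ i, ∑ j ∈ Finset.Iic k, A i j = (k + 1) * t := by
    refine Finset.sum_comm.trans ?_
    simp [hcol]
  have hrows : ∑ i ∈ Finset.Iio k, ∑ j ∈ Finset.Iic k, A i j = k * t := by
    have : ∀ i ∈ Finset.Iio k, ∑ j ∈ Finset.Iic k, A i j = t := fun i hi => by
      rw [← hrow i]
      refine Finset.sum_subset (Finset.subset_univ _) fun j _ hj => hzero i j ?_
      simp only [Finset.mem_Iio, Finset.mem_Iic, Fin.lt_def, Fin.le_def] at hi hj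
      omega
    rw [Finset.sum_congr rfl this]
    simp
  have hblock : ((k : ℤ) + 1) * (n - k) ≤ ∑ i ∈ Finset.Ici k, ∑ j ∈ Finset.Iic k, A i j := by
    have : ∑ i ∈ Finset.Ici k, ∑ j ∈ Finset.Iic k, (1 : ℤ) = ((k : ℤ) + 1) * (n - k) := by
      simp [Nat.cast_sub k.2.le, mul_comm]
    rw [← this]
    refine Finset.sum_le_sum fun i hi => Finset.sum_le_sum fun j hj => hpos i j ?_
    exact (Finset.mem_Iic.1 hj).trans (Finset.mem_Ici.1 hi)
  have hsplit : Finset.univ = Finset.Iio k ∪ Finset.Ici k := by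
    ext i; simp [lt_or_ge]
  rw [hsplit, Finset.sum_union (by
    rw [Finset.disjoint_left]; intro i; simp), hrows] at hcols
  linarith

/-- The permutation `j → j + 1 → ⋯ → i → j`, whose matrix vanishes above the superdiagonal. -/
def backCycle {n : ℕ} (i j : Fin n) (h : j ≤ i) : Equiv.Perm (Fin n) where
  toFun l := if l < j ∨ i < l then l else if hl : l = i then j else
    ⟨min (l + 1) i, by omega⟩
  invFun l := if l < j ∨ i < l then l else if l = j then i else ⟨l - 1, by omega⟩
  left_inv l := by
    simp only [Fin.lt_def, Fin.ext_iff, Fin.le_def] at *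
    split_ifs <;> simp_all <;> omega
  right_inv l := by
    simp only [Fin.lt_def, Fin.ext_iff, Fin.le_def] at *
    split_ifs <;> simp_all <;> omega

lemma exists_mem_permT_apply_eq_one {n : ℕ} {i j : Fin n} (h : j ≤ i) :
    ∃ B ∈ permT n, B i j = 1 := by
  refine ⟨(backCycle i j h).permMatrix ℝ, ⟨⟨_, rfl⟩, fun l m hlm => ?_⟩, ?_⟩
  · have : backCycle i j h l ≠ m := by
      simp only [backCycle, Equiv.coe_fn_mk, ne_eq, Fin.ext_iff, Fin.lt_def] at *
      split_ifs <;> simp_all <;> omega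
    simp [Equiv.Perm.permMatrix, PEquiv.toMatrix_apply, this]
  · have : backCycle i j h i = j := by
      simp [backCycle, h]
    simp [Equiv.Perm.permMatrix, PEquiv.toMatrix_apply, this]

/-- From a point of the intrinsic interior one can move a little away from any point of the set. -/
lemma exists_lineMap_mem_of_mem_intrinsicInterior {E : Type*} [AddCommGroup E] [Module ℝ E]
    [TopologicalSpace E] [IsTopologicalAddGroup E] [ContinuousSMul ℝ E] {s : Set E} {x y : E}
    (hx : x ∈ intrinsicInterior ℝ s) (hy : y ∈ s) :
    ∃ ε : ℝ, ε < 0 ∧ AffineMap.lineMap x y ε ∈ s := by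
  obtain ⟨x, hxs, rfl⟩ := mem_intrinsicInterior.1 hx
  let γ : ℝ → affineSpan ℝ s := fun ε => ⟨AffineMap.lineMap (x : E) y ε,
    AffineMap.lineMap_mem ε x.2 (subset_affineSpan ℝ s hy)⟩
  have hγ : Continuous γ := by
    refine Continuous.subtype_mk ?_ _
    have : ⇑(AffineMap.lineMap (x : E) y : ℝ →ᵃ[ℝ] E) = fun ε : ℝ => ε • (y - x) + (x : E) :=
      funext fun ε => AffineMap.lineMap_apply_module' _ _ _
    rw [this]
    fun_prop
  have h0 : γ 0 = x := by ext; simp [γ]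
  have hev : ∀ᶠ ε in nhds (0 : ℝ), γ ε ∈ interior (((↑) : affineSpan ℝ s → E) ⁻¹' s) :=
    hγ.continuousAt.eventually_mem (by rw [h0]; exact isOpen_interior.mem_nhds hxs)
  obtain ⟨ε, hε, hneg⟩ := ((hev.filter_mono nhdsWithin_le_nhds).and
    (self_mem_nhdsWithin (s := Set.Iio (0 : ℝ)))).exists
  have hmem := interior_subset hε
  exact ⟨ε, hneg, hmem⟩

lemma pos_of_mem_intrinsicInterior {n : ℕ} {t : ℝ} (ht : 0 < t)
    {A : Matrix (Fin n) (Fin n) ℝ} (hA : A ∈ intrinsicInterior ℝ (t • polyP n)) {i j : Fin n}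
    (h : j ≤ i) : 0 < A i j := by
  have hnonneg : ∀ C ∈ t • polyP n, 0 ≤ C i j := fun C hC => by
    rw [smul_polyP_eq_bandedTransport n ht.le] at hC
    exact hC.1 i j
  refine (hnonneg A (intrinsicInterior_subset hA)).lt_of_ne fun h0 => ?_
  obtain ⟨B, hB, hBij⟩ := exists_mem_permT_apply_eq_one h
  obtain ⟨ε, hε, hmem⟩ := exists_lineMap_mem_of_mem_intrinsicInterior hA
    (Set.smul_mem_smul_set (subset_convexHull ℝ _ hB))
  have := hnonneg _ hmem
  simp [AffineMap.lineMap_apply_module', ← h0, hBij] at this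
  nlinarith

/-! ### Lattice points of the dilates as runs -/

/-- The positions `(i, j)` with `j ≤ i` in all rows but the last, row by row. The position `(i, j)`
stands for an edge from the vertex `j` to the vertex `i + 1`. -/
def staircaseEdges (N : ℕ) : List (Fin N × Fin (N + 1)) :=
  (List.finRange N).flatMap fun i =>
    ((List.finRange (N + 1)).filter fun j => j ≤ i.castSucc).map (Prod.mk i)

/-- The source of an edge of `staircaseEdges`. -/
abbrev edgeSrc {N : ℕ} (e : Fin N × Fin (N + 1)) : Fin (N + 1) := e.2

/-- The target of an edge of `staircaseEdges`. -/
abbrev edgeTgt {N : ℕ} (e : Fin N × Fin (N + 1)) : Fin (N + 1) := e.1.succ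

lemma mem_staircaseEdges {N : ℕ} {e : Fin N × Fin (N + 1)} :
    e ∈ staircaseEdges N ↔ e.2 ≤ e.1.castSucc := by
  obtain ⟨i, j⟩ := e
  simp [staircaseEdges]

lemma nodup_staircaseEdges (N : ℕ) : (staircaseEdges N).Nodup := by
  refine List.nodup_flatMap.2 ⟨fun i _ => ?_, (List.nodup_finRange N).imp fun {i k} hik => ?_⟩
  · exact ((List.nodup_finRange _).filter _).map (Prod.mk_right_injective i)
  · simp only [Function.onFun, List.disjoint_left, List.mem_map, not_exists, not_and]
    rintro _ ⟨j, _, rfl⟩ l _ h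
    exact hik (congrArg Prod.fst h).symm

lemma pairwise_staircaseEdges (N : ℕ) : (staircaseEdges N).Pairwise fun e f => e.1 ≤ f.1 := by
  refine List.pairwise_flatMap.2 ⟨fun i _ => ?_, ?_⟩
  · exact List.pairwise_map.2 (List.pairwise_of_forall fun _ _ => le_rfl)
  · refine (List.pairwise_lt_finRange N).imp fun {i k} hik e he f hf => ?_
    simp only [List.mem_map] at he hf
    obtain ⟨_, _, rfl⟩ := he
    obtain ⟨_, _, rfl⟩ := hf
    exact hik.le

lemma edgeTgt_ne_edgeSrc_of_pairwise (N : ℕ) :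
    (staircaseEdges N).Pairwise fun e f => edgeTgt f ≠ edgeSrc e := by
  refine (pairwise_staircaseEdges N).imp_of_mem fun {e f} he _ hef => ?_
  rw [mem_staircaseEdges] at he
  exact (he.trans_lt (e.1.castSucc_lt_succ.trans_le (Fin.succ_le_succ_iff.2 hef))).ne'

/-- Every source other than the vertex `0` has received before its turn comes. -/
lemma edgeSrc_eq_zero_or_exists_edgeTgt_eq {N : ℕ} {L₁ L₂ : List (Fin N × Fin (N + 1))}
    {e : Fin N × Fin (N + 1)} (h : staircaseEdges N = L₁ ++ e :: L₂) :
    edgeSrc e = 0 ∨ ∃ f ∈ L₁, edgeTgt f = edgeSrc e := by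
  have he : e ∈ staircaseEdges N := by simp [h]
  rw [mem_staircaseEdges] at he
  obtain ⟨k, j⟩ := e
  refine j.cases (fun _ => Or.inl rfl) (fun i he => Or.inr ⟨(i, 0), ?_, rfl⟩) he
  have hik : i < k := Fin.succ_le_castSucc_iff.1 he
  have hmem : (i, 0) ∈ staircaseEdges N := mem_staircaseEdges.2 (Fin.zero_le _)
  have hsort := pairwise_staircaseEdges N
  rw [h] at hmem hsort
  rcases List.mem_append.1 hmem with h1 | h1
  · exact h1
  · rcases List.mem_cons.1 h1 with h1 | h1
    · exact absurd (congrArg Prod.fst h1) hik.ne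
    · exact absurd ((List.pairwise_cons.1 (List.pairwise_append.1 hsort).2.1).1 _ h1) hik.not_ge

/-- The state reached from `t` units at the vertex `0` by the amounts `a`. -/
abbrev staircaseState {N : ℕ} (t : ℤ) (a : Fin N × Fin (N + 1) → ℤ) : Fin (N + 1) → ℤ :=
  finalState edgeSrc edgeTgt (staircaseEdges N) (Pi.single 0 t) a

lemma staircaseState_apply {N : ℕ} (t : ℤ) {a : Fin N × Fin (N + 1) → ℤ}
    (ha : ∀ e ∉ staircaseEdges N, a e = 0) (v : Fin (N + 1)) :
    staircaseState t a v = (if v = 0 then t else 0) +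
      ∑ i : Fin N, (if v = i.succ then ∑ j, a (i, j) else 0) - ∑ i, a (i, v) := by
  rw [staircaseState, finalState_apply _ _ (nodup_staircaseEdges N), Pi.single_apply]
  have hsub : ∀ p : Fin N × Fin (N + 1) → Prop, ∀ [DecidablePred p],
      ∑ e ∈ (staircaseEdges N).toFinset, (if p e then a e else 0) =
        ∑ i, ∑ j, if p (i, j) then a (i, j) else 0 := by
    intro p _
    refine Eq.trans ?_ (Fintype.sum_prod_type fun e => if p e then a e else 0)
    refine Finset.sum_subset (Finset.subset_univ _) fun e _ he => ?_
    rw [ha e (by simpa using he), ite_self]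
  rw [hsub, hsub]
  congr 2
  · refine Finset.sum_congr rfl fun i _ => ?_
    by_cases h : v = i.succ <;> simp [h]
  · simp

/-- The matrix encoded by amounts `a` on the staircase: below the superdiagonal its rows are given
by `a` and, for the last one, by the final state; the superdiagonal makes the row sums `t`. -/
def staircaseMatrix {N : ℕ} (t : ℤ) (a : Fin N × Fin (N + 1) → ℤ) :
    Matrix (Fin (N + 1)) (Fin (N + 1)) ℤ :=
  Matrix.of (Fin.snoc (α := fun _ => Fin (N + 1) → ℤ)
    (fun i j => a (i, j) + if j = i.succ then t - ∑ l, a (i, l) else 0) (staircaseState t a))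

lemma staircaseMatrix_last {N : ℕ} (t : ℤ) (a : Fin N × Fin (N + 1) → ℤ) (j : Fin (N + 1)) :
    staircaseMatrix t a (Fin.last N) j = staircaseState t a j := by
  simp [staircaseMatrix]

lemma staircaseMatrix_castSucc {N : ℕ} (t : ℤ) (a : Fin N × Fin (N + 1) → ℤ) (i : Fin N)
    (j : Fin (N + 1)) : staircaseMatrix t a i.castSucc j =
      a (i, j) + if j = i.succ then t - ∑ l, a (i, l) else 0 := by
  simp [staircaseMatrix]

lemma staircaseMatrix_castSucc_of_le {N : ℕ} (t : ℤ) (a : Fin N × Fin (N + 1) → ℤ) {i : Fin N}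
    {j : Fin (N + 1)} (h : j ≤ i.castSucc) : staircaseMatrix t a i.castSucc j = a (i, j) := by
  rw [staircaseMatrix_castSucc, if_neg (h.trans_lt i.castSucc_lt_succ).ne, add_zero]

lemma sum_staircaseMatrix_col {N : ℕ} (t : ℤ) {a : Fin N × Fin (N + 1) → ℤ}
    (ha : ∀ e ∉ staircaseEdges N, a e = 0) (v : Fin (N + 1)) :
    ∑ i, staircaseMatrix t a i v = t := by
  rw [Fin.sum_univ_castSucc, staircaseMatrix_last, staircaseState_apply t ha]
  simp only [staircaseMatrix_castSucc, Finset.sum_add_distrib]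
  refine v.cases ?_ fun k => ?_
  · simp [(Fin.succ_ne_zero _).symm]
  · simp [Fin.succ_ne_zero]
    ring

lemma sum_staircaseMatrix_row {N : ℕ} (t : ℤ) {a : Fin N × Fin (N + 1) → ℤ}
    (ha : ∀ e ∉ staircaseEdges N, a e = 0) (i : Fin (N + 1)) :
    ∑ j, staircaseMatrix t a i j = t := by
  have hrow : ∀ i : Fin N, ∑ j, staircaseMatrix t a i.castSucc j = t := fun i => by
    simp [staircaseMatrix_castSucc, Finset.sum_add_distrib]
  -- The last row has the right sum because the columns and the other rows do.
  have htotal : ∑ i, ∑ j, staircaseMatrix t a i j = (N + 1) * t := by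
    refine Finset.sum_comm.trans ?_
    simp [sum_staircaseMatrix_col t ha]
  rw [Fin.sum_univ_castSucc] at htotal
  simp only [hrow, Finset.sum_const, Finset.card_univ, Fintype.card_fin, nsmul_eq_mul] at htotal
  refine i.lastCases ?_ hrow
  linarith

/-- In a matrix with constant row and column sums, the blocks `S × Sᶜ` and `Sᶜ × S` have the same
entry sum. -/
lemma sum_block_compl_eq {ι R : Type*} [Fintype ι] [DecidableEq ι] [CommRing R] {t : R}
    {A : ι → ι → R} (hrow : ∀ i, ∑ j, A i j = t) (hcol : ∀ j, ∑ i, A i j = t) (S : Finset ι) :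
    ∑ i ∈ S, ∑ j ∈ Sᶜ, A i j = ∑ i ∈ Sᶜ, ∑ j ∈ S, A i j := by
  have h1 : ∑ i ∈ S, ∑ j, A i j = ∑ j ∈ S, ∑ i, A i j := by simp only [hrow, hcol]
  simp only [← Finset.sum_add_sum_compl S, Finset.sum_add_distrib] at h1
  rw [Finset.sum_comm (s := S) (t := S), add_right_inj] at h1
  rw [h1, Finset.sum_comm]

lemma staircaseMatrix_mem {N : ℕ} {t : ℤ} {a : Fin N × Fin (N + 1) → ℤ}
    (ha : ∀ e ∉ staircaseEdges N, a e = 0) (h0 : ∀ e ∈ staircaseEdges N, 0 ≤ a e)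
    (hstate : ∀ v, 0 ≤ staircaseState t a v) :
    staircaseMatrix t a ∈ bandedTransport ℤ (N + 1) t := by
  have hlow : ∀ i j, j ≤ i → 0 ≤ staircaseMatrix t a i j := fun i j => by
    refine i.lastCases (fun _ => ?_) fun i h => ?_
    · rw [staircaseMatrix_last]
      exact hstate j
    · rw [staircaseMatrix_castSucc_of_le t a h]
      exact h0 _ (mem_staircaseEdges.2 h)
  have hup : ∀ (i j : Fin (N + 1)), (i : ℕ) + 2 ≤ (j : ℕ) → staircaseMatrix t a i j = 0 :=
    fun i j => by
    refine i.lastCases (fun h => ?_) fun i h => ?_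
    · have := j.2
      simp only [Fin.val_last] at h
      omega
    · simp only [Fin.val_castSucc] at h
      rw [staircaseMatrix_castSucc, ha _ (by simp [mem_staircaseEdges, Fin.lt_def]; omega),
        if_neg (by simp [Fin.ext_iff]; omega), add_zero]
  have hrow := sum_staircaseMatrix_row t ha
  have hcol := sum_staircaseMatrix_col t ha
  refine ⟨fun i j => ?_, hup, hrow, hcol⟩
  rcases le_or_gt j i with h | h
  · exact hlow i j h
  rcases le_or_gt ((i : ℕ) + 2) j with h' | h'
  · exact (hup i j h').ge
  -- A superdiagonal entry is the only one of its block right of the diagonal that may be nonzero,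
  -- so it is the sum of the complementary block, which lies below the diagonal.
  have hij : (j : ℕ) = i + 1 := by
    rw [Fin.lt_def] at h
    omega
  have hblock := sum_block_compl_eq hrow hcol (Finset.Iic i)
  have hentry : ∑ k ∈ Finset.Iic i, ∑ l ∈ (Finset.Iic i)ᶜ, staircaseMatrix t a k l =
      staircaseMatrix t a i j := by
    rw [Finset.sum_eq_single_of_mem i (by simp), Finset.sum_eq_single_of_mem j (by simpa using h)]
    · intro l hl hlj
      refine hup i l ?_
      simp only [Finset.mem_compl, Finset.mem_Iic, Fin.le_def, not_le, ne_eq, Fin.ext_iff] at *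
      omega
    · intro k hk hki
      refine Finset.sum_eq_zero fun l hl => hup k l ?_
      simp only [Finset.mem_compl, Finset.mem_Iic, Fin.le_def, not_le, ne_eq, Fin.ext_iff] at *
      omega
  rw [← hentry, hblock]
  refine Finset.sum_nonneg fun k hk => Finset.sum_nonneg fun l hl => hlow k l ?_
  simp only [Finset.mem_compl, Finset.mem_Iic, not_le] at *
  exact hl.trans hk.le

lemma exists_staircaseMatrix_eq {N : ℕ} {t : ℤ} {A : Matrix (Fin (N + 1)) (Fin (N + 1)) ℤ}
    (hA : A ∈ bandedTransport ℤ (N + 1) t) :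
    ∃ a : Fin N × Fin (N + 1) → ℤ, (∀ e ∉ staircaseEdges N, a e = 0) ∧
      (∀ e ∈ staircaseEdges N, 0 ≤ a e) ∧ staircaseMatrix t a = A := by
  obtain ⟨h0, hup, hrow, hcol⟩ := hA
  let a : Fin N × Fin (N + 1) → ℤ := fun e =>
    if e.2 ≤ e.1.castSucc then A e.1.castSucc e.2 else 0
  have ha : ∀ e ∉ staircaseEdges N, a e = 0 := fun e he => by
    rw [mem_staircaseEdges] at he
    simp [a, he]
  have hentry : ∀ i j, A (Fin.castSucc i) j =
      a (i, j) + if j = i.succ then A i.castSucc i.succ else 0 := by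
    intro i j
    rcases le_or_gt j i.castSucc with h | h
    · simp [a, h, (h.trans_lt i.castSucc_lt_succ).ne]
    · by_cases hj : j = i.succ
      · rw [if_pos hj, hj, ha _ (by simp [mem_staircaseEdges]), zero_add]
      · simp only [a, not_le.2 h, hj, if_false, add_zero]
        refine hup _ _ ?_
        simp only [Fin.lt_def, Fin.ext_iff, Fin.val_castSucc, Fin.val_succ] at *
        omega
  have hcast : ∀ i j, staircaseMatrix t a (Fin.castSucc i) j = A i.castSucc j := by
    intro i j
    have : t - ∑ l, a (i, l) = A i.castSucc i.succ := by
      rw [← hrow i.castSucc, Finset.sum_congr rfl fun j _ => hentry i j, Finset.sum_add_distrib]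
      simp
    rw [staircaseMatrix_castSucc, this, ← hentry]
  refine ⟨a, ha, fun e _ => ?_, ?_⟩
  · change 0 ≤ if e.2 ≤ e.1.castSucc then A e.1.castSucc e.2 else 0
    split_ifs
    exacts [h0 _ _, le_rfl]
  · ext i j
    refine i.lastCases ?_ fun i => hcast i j
    have h1 := sum_staircaseMatrix_col t ha j
    have h2 := h1.trans (hcol j).symm
    rw [Fin.sum_univ_castSucc, Fin.sum_univ_castSucc] at h2
    simpa only [hcast, add_right_inj] using h2

/-- The signed number of runs along the staircase from `t` units at the vertex `0`. -/
noncomputable abbrev staircaseCount (N : ℕ) (t : ℤ) : ℚ :=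
  runCount edgeSrc edgeTgt (staircaseEdges N) (Pi.single 0 t)

lemma staircaseCount_eq_ncard (N t : ℕ) :
    staircaseCount N t = (bandedTransport ℤ (N + 1) (t : ℤ)).ncard := by
  have hx : ∀ v : Fin (N + 1), 0 ≤ (Pi.single 0 (t : ℤ) : Fin (N + 1) → ℤ) v := fun v => by
    rw [Pi.single_apply]
    split_ifs <;> simp
  obtain ⟨s, hs, hcard⟩ := exists_finset_card_eq_runCount (src := edgeSrc) (tgt := edgeTgt)
    (nodup_staircaseEdges N) hx
  have hiff : ∀ a, a ∈ s ↔ ((∀ e ∈ staircaseEdges N, 0 ≤ a e) ∧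
      ∀ v, 0 ≤ staircaseState t a v) ∧ ∀ e ∉ staircaseEdges N, a e = 0 := fun a => by
    rw [hs, isRun_iff_of_nonneg (edgeTgt_ne_edgeSrc_of_pairwise N) (fun e he => ?_) hx]
    rw [mem_staircaseEdges] at he
    exact (he.trans_lt e.1.castSucc_lt_succ).ne'
  have himage : bandedTransport ℤ (N + 1) (t : ℤ) = staircaseMatrix (t : ℤ) '' s := by
    ext A
    constructor
    · intro hA
      obtain ⟨a, ha, h0, rfl⟩ := exists_staircaseMatrix_eq hA
      refine ⟨a, (hiff a).2 ⟨⟨h0, fun v => ?_⟩, ha⟩, rfl⟩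
      rw [← staircaseMatrix_last]
      exact hA.1 _ _
    · rintro ⟨a, ha, rfl⟩
      obtain ⟨⟨h0, hstate⟩, hsupp⟩ := (hiff a).1 ha
      exact staircaseMatrix_mem hsupp h0 hstate
  rw [staircaseCount, hcard, himage, Set.InjOn.ncard_image, Set.ncard_coe_finset]
  intro a ha b hb hab
  ext e
  by_cases he : e ∈ staircaseEdges N
  · rw [mem_staircaseEdges] at he
    rw [← staircaseMatrix_castSucc_of_le t a he, hab, staircaseMatrix_castSucc_of_le t b he]
  · rw [((hiff a).1 ha).2 e he, ((hiff b).1 hb).2 e he]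

/-- A nonzero signed count at `-t` provides a strictly negative run; its negative encodes a matrix
in `bandedTransport ℤ (N + 1) t` that is positive on and below the diagonal. -/
lemma le_of_staircaseCount_neg_ne_zero {N : ℕ} {t : ℤ} (ht : 0 < t)
    (h : staircaseCount N (-t) ≠ 0) (k : Fin (N + 1)) :
    ((k : ℤ) + 1) * ((N + 1 : ℕ) - k) ≤ t := by
  obtain ⟨a, ha⟩ := exists_isRun_of_runCount_ne_zero (nodup_staircaseEdges N) h
  have hx : ∀ v : Fin (N + 1), (Pi.single 0 (-t) : Fin (N + 1) → ℤ) v ≤ 0 := fun v => by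
    rw [Pi.single_apply]
    split_ifs <;> omega
  let b : Fin N × Fin (N + 1) → ℤ := fun e => if e ∈ staircaseEdges N then -a e else 0
  have hb : IsRun edgeSrc edgeTgt (staircaseEdges N) (Pi.single 0 (-t)) (-b) :=
    ha.congr fun e he => by simp [b, he]
  obtain ⟨h1, h2⟩ := hb.neg (S := {0}) hx (by simpa using ht)
    fun L₁ e L₂ => edgeSrc_eq_zero_or_exists_edgeTgt_eq
  have hb0 : ∀ e ∉ staircaseEdges N, b e = 0 := fun e he => by simp [b, he]
  have hpos : ∀ e ∈ staircaseEdges N, 0 < b e := fun e he => by simpa using h1 e he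
  have hstate : ∀ v, 0 < staircaseState t b v := fun v => by
    have := h2 v (v.cases (Or.inl rfl) fun i =>
      Or.inr ⟨(i, 0), mem_staircaseEdges.2 (Fin.zero_le _), rfl⟩)
    rw [Pi.single_neg, finalState_neg] at this
    simpa using this
  refine mul_le_of_mem_bandedTransport
    (staircaseMatrix_mem hb0 (fun e he => (hpos e he).le) fun v => (hstate v).le) (fun i j => ?_) k
  refine i.lastCases (fun _ => ?_) fun i hij => ?_
  · rw [staircaseMatrix_last]
    exact hstate j
  · rw [staircaseMatrix_castSucc_of_le t b hij]
    exact hpos _ (mem_staircaseEdges.2 hij)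

/-! ### The Ehrhart polynomial -/

lemma IsEhrhartPolynomial.unique {n : ℕ} {P : Set (Matrix (Fin n) (Fin n) ℝ)}
    {e f : Polynomial ℚ} (he : IsEhrhartPolynomial P e) (hf : IsEhrhartPolynomial P f) : e = f :=
  Polynomial.eq_of_infinite_eval_eq e f <|
    (Set.infinite_range_of_injective Nat.cast_injective).mono <| by
      rintro _ ⟨t, rfl⟩
      exact (he t).trans (hf t).symm

lemma exists_isEhrhartPolynomial_polyP (N : ℕ) : ∃ e : Polynomial ℚ,
    IsEhrhartPolynomial (polyP (N + 1)) e ∧ ∀ t : ℤ, e.eval (t : ℚ) = staircaseCount N t := by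
  obtain ⟨e, he⟩ := exists_polynomial_runCount_single (src := edgeSrc) (tgt := edgeTgt)
    (staircaseEdges N) 0
  refine ⟨e, fun t => ?_, fun t => (he t).symm⟩
  rw [latticePoints_smul_polyP, ← staircaseCount_eq_ncard, staircaseCount, he, Int.cast_natCast]

lemma eval_neg_eq_zero_of_lt {n : ℕ} {e : Polynomial ℚ} (he : IsEhrhartPolynomial (polyP n) e)
    {t k : ℕ} (ht : 1 ≤ t) (hk : k < n) (hlt : t < (k + 1) * (n - k)) :
    e.eval (-(t : ℚ)) = 0 := by
  obtain ⟨N, rfl⟩ := Nat.exists_eq_succ_of_ne_zero (Nat.ne_zero_of_lt hk)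
  obtain ⟨f, hf, hcount⟩ := exists_isEhrhartPolynomial_polyP N
  have heval := hcount (-(t : ℤ))
  push_cast at heval
  rw [he.unique hf, heval]
  by_contra h
  have hle := le_of_staircaseCount_neg_ne_zero (by exact_mod_cast ht) h ⟨k, hk⟩
  rw [← Nat.cast_sub hk.le] at hle
  exact absurd hlt (not_lt.2 (by exact_mod_cast hle))

theorem mainTheorem4 (n : ℕ) (hn : 2 ≤ n) :
    (∀ t : ℕ, 1 ≤ t →
      (latticePoints (intrinsicInterior ℝ ((t : ℝ) • polyP n))).Nonempty →
        (Finset.range n).sup (fun k => (k + 1) * (n - k)) ≤ t) ∧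
    (∃! e : Polynomial ℚ, IsEhrhartPolynomial (polyP n) e) ∧
    (∀ e : Polynomial ℚ, IsEhrhartPolynomial (polyP n) e →
      (∀ m : ℕ, n = 2 * m + 1 →
        ∀ t : ℕ, 1 ≤ t → t ≤ (m + 1) ^ 2 - 1 → e.eval (-(t : ℚ)) = 0) ∧
      (∀ m : ℕ, n = 2 * m →
        ∀ t : ℕ, 1 ≤ t → t ≤ m * (m + 1) - 1 → e.eval (-(t : ℚ)) = 0)) := by
  refine ⟨?_, ?_, fun e he => ⟨?_, ?_⟩⟩
  · rintro t ht ⟨A, hA⟩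
    refine Finset.sup_le fun k hk => ?_
    have hk := Finset.mem_range.1 hk
    have hmem : A ∈ latticePoints ((t : ℝ) • polyP n) :=
      intrinsicInterior_subset (𝕜 := ℝ) (s := (t : ℝ) • polyP n) hA
    rw [latticePoints_smul_polyP] at hmem
    have hpos : ∀ i j, j ≤ i → 0 < A i j := fun i j hij => by
      have := pos_of_mem_intrinsicInterior (by positivity) hA hij
      simpa using this
    have hle := mul_le_of_mem_bandedTransport hmem hpos ⟨k, hk⟩
    rw [← Nat.cast_sub hk.le] at hle
    exact_mod_cast hle
  · obtain ⟨N, rfl⟩ := Nat.exists_eq_succ_of_ne_zero (by omega : n ≠ 0)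
    obtain ⟨e, he, -⟩ := exists_isEhrhartPolynomial_polyP N
    exact ⟨e, he, fun f hf => hf.unique he⟩
  -- For both parities the maximum of `(k + 1) * (n - k)` is attained at `k = m`.
  · rintro m rfl t ht hle
    refine eval_neg_eq_zero_of_lt he ht (k := m) (by omega) ?_
    rw [show 2 * m + 1 - m = m + 1 by omega, ← sq]
    omega
  · rintro m rfl t ht hle
    refine eval_neg_eq_zero_of_lt he ht (k := m) (by omega) ?_
    rw [show 2 * m - m = m by omega, mul_comm]
    omega
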